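/- Let $\Omega\subseteq\mathbb R^2$ be open. Consider real functions that are defined and smooth on a dense open subset of $\Omega$, two of them being identified when they agree on a dense open subset of $\Omega$. Let $K$ be a set of such functions that is a field under pointwise operations and is closed under $\partial/\partial x$ and $\partial/\partial y$ (for example $\mathbb Q(x,y)$). An element $f\in K$ is said to depend on $x$ only if, near every point of some dense open subset of $\Omega$, its value does not change with $y$. A differential operator $P(x,y)=\sum_{n} a_nD^n$, $D=\partial/\partial x$, is a finite sum with coefficients $a_n\in K$; we write $P(x)$ if all $a_n$ depend on $x$ only. Let $k\ge 0$ and let $\overline L(x,y)=(L_1(x,y),\dots,L_k(x,y))$ be a row of such operators, defining the Euler multiintegral $$\mathcal J=\overline L(x,y)\mathring\varphi(x)=L_1(x,y)\varphi_1(x)+\dots+L_k(x,y)\varphi_k(x).$$ * $\mathcal J$ is called *operator-reducible* if $\overline L(x,y)=\overline M(x,y)\,\widehat R(x)$ (composition of operators) for some $p\le k$, some row $\overline M=(M_1(x,y),\dots,M_p(x,y))$ of operators and some $p\times k$ matrix $\widehat R(x)=(R_{ij}(x))$ of operators that is not invertible, i.e. there is no $k\times p$ matrix $\widehat S(x)$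 of operators with $\widehat R\widehat S=1$ and $\widehat S\widehat R=1$. All operators here have coefficients in $K$, and those of $R_{ij}(x)$ and of the entries of $\widehat S(x)$ depend on $x$ only. * $\mathcal J$ is called *kernel-reducible* if there are an open box $I\times I'\subseteq\Omega$ ($I,I'$ nonempty bounded open intervals), on which all coefficients of $L_1,\dots,L_k$ are defined and smooth, and smooth functions $\varphi_1(x),\dots,\varphi_k(x)$ on $I$, not all identically zero, such that $L_1(x,y)\varphi_1(x)+\dots+L_k(x,y)\varphi_k(x)=0$ for all $(x,y)\in I\times I'$. **Theorem.** $\mathcal J$ is operator-reducible if and only if it is kernel-reducible. -/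

import Mathlib

open scoped ContDiff Topology

noncomputable section

namespace Multiintegral

open Filter TopologicalSpace

/-- The filter of those sets that contain a dense open subset of the open set `Ω`. "Generically on
`Ω`" means: on some dense open subset of `Ω`, e.g. off the zero set of a denominator. -/
def generic (Ω : Opens (ℝ × ℝ)) : Filter (ℝ × ℝ) where
  sets := {s | (Ω : Set (ℝ × ℝ)) ⊆ closure (interior s)}
  univ_sets := by simp
  sets_of_superset := fun hs hst => hs.trans (closure_mono (interior_mono hst))
  inter_sets := by
    intro s t hs ht p hp
    rw [mem_closure_iff]
    intro W hW hpW
    obtain ⟨q, ⟨hqW, hqΩ⟩, hqs⟩ :=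
      mem_closure_iff.1 (hs hp) (W ∩ Ω) (hW.inter Ω.isOpen) ⟨hpW, hp⟩
    obtain ⟨r, ⟨hrW, hrs⟩, hrt⟩ :=
      mem_closure_iff.1 (ht hqΩ) (W ∩ interior s) (hW.inter isOpen_interior) ⟨hqW, hqs⟩
    exact ⟨r, hrW, by rw [interior_inter]; exact ⟨hrs, hrt⟩⟩

/-- A generic property holds generically on a neighbourhood of a generic point. -/
theorem generic_nhds {Ω : Opens (ℝ × ℝ)} {P : ℝ × ℝ → Prop} (h : ∀ᶠ p in generic Ω, P p) :
    ∀ᶠ p in generic Ω, ∀ᶠ q in 𝓝 p, P q := by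
  have h' : (Ω : Set (ℝ × ℝ)) ⊆ closure (interior {p | P p}) := h
  change (Ω : Set (ℝ × ℝ)) ⊆ closure (interior {p | ∀ᶠ q in 𝓝 p, P q})
  refine h'.trans (closure_mono (interior_maximal ?_ isOpen_interior))
  intro p hp
  exact mem_interior_iff_mem_nhds.1 hp

/-- The ring of functions that are defined and smooth on a dense open subset of `Ω`, two of
them being identified when they agree on a dense open subset of `Ω`. -/
def SmoothFun (Ω : Opens (ℝ × ℝ)) : Subring (Germ (generic Ω) ℝ) where
  carrier := {a | ∃ f : ℝ × ℝ → ℝ, (f : Germ (generic Ω) ℝ) = a ∧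
    ∀ᶠ p in generic Ω, ContDiffAt ℝ ∞ f p}
  mul_mem' := by
    rintro _ _ ⟨f, rfl, hf⟩ ⟨g, rfl, hg⟩
    exact ⟨f * g, rfl, by filter_upwards [hf, hg] with p h₁ h₂ using h₁.mul h₂⟩
  add_mem' := by
    rintro _ _ ⟨f, rfl, hf⟩ ⟨g, rfl, hg⟩
    exact ⟨f + g, rfl, by filter_upwards [hf, hg] with p h₁ h₂ using h₁.add h₂⟩
  zero_mem' := ⟨fun _ => 0, rfl, Eventually.of_forall fun _ => contDiffAt_const⟩
  one_mem' := ⟨fun _ => 1, rfl, Eventually.of_forall fun _ => contDiffAt_const⟩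
  neg_mem' := by
    rintro _ ⟨f, rfl, hf⟩
    exact ⟨-f, rfl, by filter_upwards [hf] with p h using h.neg⟩

variable {Ω : Opens (ℝ × ℝ)}

/-- Directional derivative of a generically defined function (meaningful on `SmoothFun Ω`). -/
def germDeriv (v : ℝ × ℝ) : Germ (generic Ω) ℝ → Germ (generic Ω) ℝ :=
  Quotient.map' (fun f p => fderiv ℝ f p v) (by
    intro f g h
    have h' : ∀ᶠ p in generic Ω, f p = g p := h
    change ∀ᶠ p in generic Ω, fderiv ℝ f p v = fderiv ℝ g p v
    filter_upwards [generic_nhds h'] with p hp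
    have : f =ᶠ[𝓝 p] g := hp
    rw [this.fderiv_eq])

theorem germDeriv_coe (v : ℝ × ℝ) (f : ℝ × ℝ → ℝ) :
    germDeriv v (f : Germ (generic Ω) ℝ) = ((fun p => fderiv ℝ f p v : ℝ × ℝ → ℝ) :) := rfl

theorem germDeriv_mem (v : ℝ × ℝ) {a : Germ (generic Ω) ℝ} (ha : a ∈ SmoothFun Ω) :
    germDeriv v a ∈ SmoothFun Ω := by
  obtain ⟨f, rfl, hf⟩ := ha
  refine ⟨_, rfl, ?_⟩
  filter_upwards [hf] with p hp
  exact (hp.fderiv_right (m := ∞) (by simp)).clm_apply contDiffAt_const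

theorem germDeriv_add (v : ℝ × ℝ) {a b : Germ (generic Ω) ℝ} (ha : a ∈ SmoothFun Ω)
    (hb : b ∈ SmoothFun Ω) : germDeriv v (a + b) = germDeriv v a + germDeriv v b := by
  obtain ⟨f, rfl, hf⟩ := ha
  obtain ⟨g, rfl, hg⟩ := hb
  refine Germ.coe_eq.2 ?_
  filter_upwards [hf, hg] with p h₁ h₂
  change fderiv ℝ (f + g) p v = fderiv ℝ f p v + fderiv ℝ g p v
  rw [fderiv_add (h₁.differentiableAt (by simp)) (h₂.differentiableAt (by simp))]
  rfl

theorem germDeriv_mul (v : ℝ × ℝ) {a b : Germ (generic Ω) ℝ} (ha : a ∈ SmoothFun Ω)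
    (hb : b ∈ SmoothFun Ω) : germDeriv v (a * b) = a * germDeriv v b + b * germDeriv v a := by
  obtain ⟨f, rfl, hf⟩ := ha
  obtain ⟨g, rfl, hg⟩ := hb
  refine Germ.coe_eq.2 ?_
  filter_upwards [hf, hg] with p h₁ h₂
  change fderiv ℝ (f * g) p v = f p * fderiv ℝ g p v + g p * fderiv ℝ f p v
  rw [fderiv_mul (h₁.differentiableAt (by simp)) (h₂.differentiableAt (by simp))]
  rfl

/-- The partial derivative along `v` as a derivation of the ring `SmoothFun Ω`. -/
def partialDeriv (v : ℝ × ℝ) : Derivation ℤ (SmoothFun Ω) (SmoothFun Ω) :=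
  Derivation.mk'
    (AddMonoidHom.mk' (fun a : SmoothFun Ω => (⟨germDeriv v a, germDeriv_mem v a.2⟩ : SmoothFun Ω))
      (fun a b => Subtype.ext (germDeriv_add v a.2 b.2))).toIntLinearMap
    (fun a b => Subtype.ext (germDeriv_mul v a.2 b.2))

/-- `∂/∂x`. -/
def dx : Derivation ℤ (SmoothFun Ω) (SmoothFun Ω) := partialDeriv (1, 0)

/-- `∂/∂y`. -/
def dy : Derivation ℤ (SmoothFun Ω) (SmoothFun Ω) := partialDeriv (0, 1)

/-- `K` is a differential field of functions of the two variables `(x, y)`: a field, closed under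
`∂/∂x` and `∂/∂y`. -/
structure IsDifferentialField (K : Subring (SmoothFun Ω)) : Prop where
  isField : IsField K
  dx_mem : ∀ a ∈ K, dx a ∈ K
  dy_mem : ∀ a ∈ K, dy a ∈ K

/-- The function depends on `x` only: near every point of some dense open set its value does not
change with `y`. -/
def DependsOnlyOnX (a : SmoothFun Ω) : Prop :=
  ∃ f : ℝ × ℝ → ℝ, (f : Germ (generic Ω) ℝ) = a ∧
    ∀ᶠ p in generic Ω, ∀ᶠ q in 𝓝 p, f q = f (q.1, p.2)

/-- A linear ordinary differential operator `∑ₙ aₙ Dⁿ` in `x`, given by its coefficients `aₙ`,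
finitely many of which are nonzero. -/
abbrev DiffOp (Ω : Opens (ℝ × ℝ)) : Type := ℕ →₀ SmoothFun Ω

/-- The operator `f ↦ ∑ₙ aₙ (∂/∂x)ⁿ f`; the composition of operators is the product in
`Module.End`. -/
def DiffOp.toEnd (P : DiffOp Ω) : Module.End ℤ (SmoothFun Ω) :=
  P.sum fun n a => LinearMap.mulLeft ℤ a * (dx.toLinearMap : Module.End ℤ (SmoothFun Ω)) ^ n

/-- `P = P(x,y)` has coefficients in the field `K`. -/
def DiffOp.IsXY (K : Subring (SmoothFun Ω)) (P : DiffOp Ω) : Prop := ∀ n, P n ∈ K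

/-- `P = P(x)` has coefficients in the field `K` that depend on `x` only. -/
def DiffOp.IsX (K : Subring (SmoothFun Ω)) (P : DiffOp Ω) : Prop :=
  ∀ n, P n ∈ K ∧ DependsOnlyOnX (P n)

/-- A matrix of differential operators `R̂(x)` has a two-sided inverse `Ŝ(x)` among the matrices of
such operators. -/
def IsInvertible (K : Subring (SmoothFun Ω)) {p k : ℕ} (R : Matrix (Fin p) (Fin k) (DiffOp Ω)) :
    Prop :=
  ∃ S : Matrix (Fin k) (Fin p) (DiffOp Ω), (∀ i j, (S i j).IsX K) ∧
    R.map DiffOp.toEnd * S.map DiffOp.toEnd = 1 ∧ S.map DiffOp.toEnd * R.map DiffOp.toEnd = 1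

/-- The operator row `L̄(x,y)` is a composition `M̄(x,y) R̂(x)` with a non-invertible `p × k` matrix
`R̂(x)`, `p ≤ k`. -/
def IsOperatorReducible (K : Subring (SmoothFun Ω)) {k : ℕ} (L : Fin k → DiffOp Ω) : Prop :=
  ∃ p : ℕ, p ≤ k ∧ ∃ (M : Fin p → DiffOp Ω) (R : Matrix (Fin p) (Fin k) (DiffOp Ω)),
    (∀ i, (M i).IsXY K) ∧ (∀ i j, (R i j).IsX K) ∧
    (∀ j, (L j).toEnd = ∑ i, (M i).toEnd * (R i j).toEnd) ∧
    ¬ IsInvertible K R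

/-- There are an open box `(a,b) × (c,d)` in `Ω` on which all coefficients of the operators `Lᵢ` are
defined and smooth, and smooth functions `φ₁(x), …, φₖ(x)` on `(a,b)`, not all identically zero, such
that `L₁ φ₁ + … + Lₖ φₖ` vanishes on this box. -/
def IsKernelReducible {k : ℕ} (L : Fin k → DiffOp Ω) : Prop :=
  ∃ a b c d : ℝ, a < b ∧ c < d ∧ Set.Ioo a b ×ˢ Set.Ioo c d ⊆ (Ω : Set (ℝ × ℝ)) ∧
    ∃ l : Fin k → ℕ → ℝ × ℝ → ℝ,
      (∀ i n, (l i n : Germ (generic Ω) ℝ) = L i n) ∧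
      (∀ i n, ContDiffOn ℝ ∞ (l i n) (Set.Ioo a b ×ˢ Set.Ioo c d)) ∧
      ∃ φ : Fin k → ℝ → ℝ,
        (∀ i, ContDiffOn ℝ ∞ (φ i) (Set.Ioo a b)) ∧
        (∃ i, ∃ x ∈ Set.Ioo a b, φ i x ≠ 0) ∧
        ∀ x ∈ Set.Ioo a b, ∀ y ∈ Set.Ioo c d,
          ∑ i, ∑ n ∈ (L i).support, l i n (x, y) * iteratedDeriv n (φ i) x = 0

end Multiintegral

end

/-! Let `C` be the field of elements of `K` killed by `∂/∂y`, and let `A = C[D]` be the ring of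
operators with coefficients in `C`. Division by a monic operator makes every left ideal of `A`
principal, so `A` is left Noetherian. "Depends on `x` only" becomes "`dy` vanishes", and kernel
reducibility becomes the existence of a nonzero vector `φ` of germs with `dy φ = 0` and `L φ = 0`
(`isKernelReducible_iff`): a local solution extended by zero is still generically smooth.

Operator to kernel: let `L = M R`. If the rows of `R` spanned `A ^ k`, then `R` would have a left
inverse, and `p ≤ k` with the Noetherian property would make it two-sided
(`exists_inverse_of_span_eq_top`). So the row module is proper and lies in a maximal submodule, with
quotient a cyclic module `A / I`, `I` proper. The generator of `I` is zero or a monic operator of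
positive order, which kills a nonzero function of `x` by the existence theorem for linear ODEs.
Multiples of that function form a vector killed by `R` (`exists_annihilated_vector`), hence by `L`.

Kernel to operator: expand the coefficients of `L` as `L = ∑ e_α row_α`, with `e_α ∈ K` independent
over `C` and `row_α` over `A`. A Wronskian-type argument in `y` (`eq_zero_of_sum_mul_eq_zero`) keeps
the `e_α` independent over all functions of `x`, so every `row_α` kills `φ`. The module spanned by
these rows is generated by `k` vectors (`exists_fin_generators`); they form a square `R` that kills
`φ ≠ 0`, so it is not invertible, and `L` factors through it. -/

noncomputable section

namespace Multiintegral

open Filter TopologicalSpace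

/-! ### Rings of differential operators and left division -/

section Operators

variable {S : Type*} [CommRing S] (δ : Derivation ℤ S S) (C : Subring S)

/-- The derivation as an element of the ring of additive endomorphisms. -/
abbrev derivEnd : Module.End ℤ S := δ.toLinearMap

/-- The differential operators of order less than `n` with coefficients in `C`. -/
def opFil (n : ℕ) : Submodule C (Module.End ℤ S) :=
  Submodule.span C ((fun i => derivEnd δ ^ i) '' Set.Iio n)

/-- The differential operators with coefficients in `C`. -/
def opSpan : Submodule C (Module.End ℤ S) :=
  Submodule.span C (Set.range fun i => derivEnd δ ^ i)

variable {δ C}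

theorem derivEnd_mul_smul (a : C) (T : Module.End ℤ S) :
    derivEnd δ * (a • T) = a • (derivEnd δ * T) + δ (a : S) • T := by
  ext s
  simp [Subring.smul_def, mul_comm]

theorem pow_mem_opFil {i n : ℕ} (h : i < n) : derivEnd δ ^ i ∈ opFil δ C n :=
  Submodule.subset_span ⟨i, h, rfl⟩

theorem opFil_mono {m n : ℕ} (h : m ≤ n) : opFil δ C m ≤ opFil δ C n :=
  Submodule.span_mono (Set.image_mono fun _ hi => lt_of_lt_of_le hi h)

theorem opFil_le_opSpan (n : ℕ) : opFil δ C n ≤ opSpan δ C :=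
  Submodule.span_mono (Set.image_subset_range _ _)

theorem opFil_zero : opFil δ C 0 = ⊥ := by
  simp [opFil]

theorem exists_mem_opFil {T : Module.End ℤ S} (hT : T ∈ opSpan δ C) : ∃ n, T ∈ opFil δ C n := by
  induction hT using Submodule.span_induction with
  | mem x hx =>
    obtain ⟨i, rfl⟩ := hx
    exact ⟨i + 1, pow_mem_opFil i.lt_succ_self⟩
  | zero => exact ⟨0, zero_mem _⟩
  | add x y _ _ hx hy =>
    obtain ⟨m, hm⟩ := hx
    obtain ⟨n, hn⟩ := hy
    exact ⟨max m n, add_mem (opFil_mono (le_max_left _ _) hm) (opFil_mono (le_max_right _ _) hn)⟩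
  | smul a x _ hx =>
    obtain ⟨m, hm⟩ := hx
    exact ⟨m, Submodule.smul_mem _ _ hm⟩

theorem exists_eq_smul_pow_add {n : ℕ} {T : Module.End ℤ S} (hT : T ∈ opFil δ C (n + 1)) :
    ∃ a : C, ∃ U ∈ opFil δ C n, T = a • derivEnd δ ^ n + U := by
  have : Set.Iio (n + 1) = insert n (Set.Iio n) := by
    ext i
    simp only [Set.mem_Iio, Set.mem_insert_iff]
    omega
  rw [opFil, this, Set.image_insert_eq, Submodule.mem_span_insert] at hT
  exact hT

/-- Leibniz, `D a = a D + δ(a)`: the second term keeps its order, and has coefficients in `C`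
because `C` is closed under `δ`. -/
theorem derivEnd_mul_mem_opFil (hC : ∀ a ∈ C, δ a ∈ C) {n : ℕ} {T : Module.End ℤ S}
    (hT : T ∈ opFil δ C n) : derivEnd δ * T ∈ opFil δ C (n + 1) := by
  induction hT using Submodule.span_induction with
  | mem x hx =>
    obtain ⟨i, hi, rfl⟩ := hx
    rw [← pow_succ']
    exact pow_mem_opFil (Nat.succ_lt_succ hi)
  | zero => simp
  | add x y _ _ hx hy => rw [mul_add]; exact add_mem hx hy
  | smul a x hx' hx =>
    rw [derivEnd_mul_smul]
    exact add_mem (Submodule.smul_mem _ _ hx)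
      (opFil_mono n.le_succ (Submodule.smul_mem _ (⟨δ a, hC a a.2⟩ : C) hx'))

theorem pow_mul_mem_opFil (hC : ∀ a ∈ C, δ a ∈ C) {n : ℕ} {T : Module.End ℤ S}
    (hT : T ∈ opFil δ C n) (j : ℕ) : derivEnd δ ^ j * T ∈ opFil δ C (j + n) := by
  induction j with
  | zero => simpa using hT
  | succ j ih =>
    rw [pow_succ', mul_assoc, add_right_comm]
    exact derivEnd_mul_mem_opFil hC ih

variable (δ C) in
/-- The ring of differential operators with coefficients in `C`. -/
def opRing (hC : ∀ a ∈ C, δ a ∈ C) : Subring (Module.End ℤ S) where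
  carrier := opSpan δ C
  one_mem' := Submodule.subset_span ⟨0, rfl⟩
  zero_mem' := zero_mem _
  add_mem' := fun h h' => add_mem h h'
  neg_mem' := fun h => neg_mem (s := opSpan δ C) h
  mul_mem' := by
    intro T U hT hU
    obtain ⟨n, hU⟩ := exists_mem_opFil hU
    change T ∈ opSpan δ C at hT
    change T * U ∈ opSpan δ C
    induction hT using Submodule.span_induction with
    | mem x hx =>
      obtain ⟨i, rfl⟩ := hx
      exact opFil_le_opSpan _ (pow_mul_mem_opFil hC hU i)
    | zero => simp
    | add x y _ _ hx hy => rw [add_mul]; exact add_mem hx hy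
    | smul a x _ hx => rw [smul_mul_assoc]; exact Submodule.smul_mem _ _ hx

theorem mem_opRing {hC : ∀ a ∈ C, δ a ∈ C} {T : Module.End ℤ S} :
    T ∈ opRing δ C hC ↔ T ∈ opSpan δ C := Iff.rfl

instance opRing.module (hC : ∀ a ∈ C, δ a ∈ C) : Module (opRing δ C hC) S :=
  Module.compHom S (opRing δ C hC).subtype

/-- Left ideals of the ring of differential operators over a field are generated by zero or by a
monic operator. -/
theorem exists_monic_generator (hC : ∀ a ∈ C, δ a ∈ C)
    (hinv : ∀ a : C, a ≠ 0 → ∃ b : C, b * a = 1) (I : Ideal (opRing δ C hC)) :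
    ∃ d : opRing δ C hC, I = Ideal.span {d} ∧
      (d = 0 ∨ ∃ m, ∃ U ∈ opFil δ C m, (d : Module.End ℤ S) = derivEnd δ ^ m + U) := by
  classical
  by_cases hI : I = ⊥
  · exact ⟨0, by simpa using hI, Or.inl rfl⟩
  obtain ⟨T₀, hT₀, hT₀0⟩ := Submodule.exists_mem_ne_zero_of_ne_bot hI
  have hex : ∃ n, ∃ T ∈ I, T ≠ 0 ∧ (T : Module.End ℤ S) ∈ opFil δ C n := by
    obtain ⟨n, hn⟩ := exists_mem_opFil (mem_opRing.1 T₀.2)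
    exact ⟨n, T₀, hT₀, hT₀0, hn⟩
  -- A nonzero element of least order in `I`; made monic, it will be the generator.
  obtain ⟨n, ⟨T, hTI, hT0, hT⟩, hmin⟩ : ∃ n, (∃ T ∈ I, T ≠ 0 ∧ (T : Module.End ℤ S) ∈ opFil δ C n) ∧
      ∀ m < n, ¬ ∃ T ∈ I, T ≠ 0 ∧ (T : Module.End ℤ S) ∈ opFil δ C m :=
    ⟨Nat.find hex, Nat.find_spec hex, fun m => Nat.find_min hex⟩
  rcases n with _ | m
  · rw [opFil_zero, Submodule.mem_bot] at hT
    exact (hT0 (Subtype.ext hT)).elim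
  obtain ⟨a, U, hU, hTU⟩ := exists_eq_smul_pow_add hT
  have ha : a ≠ 0 := by
    rintro rfl
    refine hmin m m.lt_succ_self ⟨T, hTI, hT0, ?_⟩
    simpa [hTU] using hU
  -- Scaling by `c` is realised as left multiplication inside the ring, so that left ideals are
  -- closed under it.
  have hsmul : ∀ (c : C) (X : opRing δ C hC), ∃ Y : opRing δ C hC, ∀ Z : opRing δ C hC,
      ((Y * Z : opRing δ C hC) : Module.End ℤ S) = c • ((X * Z : opRing δ C hC) : Module.End ℤ S) :=
    fun c X => ⟨⟨c • X.1, Submodule.smul_mem (opSpan δ C) c X.2⟩, fun Z => smul_mul_assoc c X.1 Z.1⟩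
  obtain ⟨b, hb⟩ := hinv a ha
  obtain ⟨Y, hY⟩ := hsmul b 1
  have hd : ((Y * T : opRing δ C hC) : Module.End ℤ S) = derivEnd δ ^ m + b • U := by
    rw [hY, one_mul, hTU, smul_add, smul_smul, hb, one_smul]
  refine ⟨Y * T, le_antisymm ?_ ?_, Or.inr ⟨m, b • U, Submodule.smul_mem _ _ hU, hd⟩⟩
  · have key : ∀ r, ∀ X ∈ I, (X : Module.End ℤ S) ∈ opFil δ C r → X ∈ Ideal.span {Y * T} := by
      intro r
      induction r with
      | zero =>
        intro X _ hX
        rw [opFil_zero, Submodule.mem_bot] at hX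
        have : X = 0 := Subtype.ext hX
        rw [this]
        exact zero_mem _
      | succ r ih =>
        intro X hXI hX
        by_cases hr : r < m
        · by_cases hX0 : X = 0
          · rw [hX0]; exact zero_mem _
          · exact (hmin (r + 1) (by omega) ⟨X, hXI, hX0, hX⟩).elim
        · obtain ⟨c, V, hV, hXV⟩ := exists_eq_smul_pow_add hX
          obtain ⟨Q, hQ⟩ := hsmul c ⟨derivEnd δ ^ (r - m), Submodule.subset_span ⟨_, rfl⟩⟩
          have h1 : Q * (Y * T) ∈ Ideal.span {Y * T} :=
            Ideal.mul_mem_left _ _ (Ideal.mem_span_singleton_self _)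
          -- Division step: `Q = c D ^ (r - m)` cancels the leading term `c D ^ r` of `X`.
          have h2 : X - Q * (Y * T) ∈ Ideal.span {Y * T} := by
            refine ih _ (sub_mem hXI (I.mul_mem_left _ (I.mul_mem_left _ hTI))) ?_
            have : ((X - Q * (Y * T) : opRing δ C hC) : Module.End ℤ S) =
                V - c • (derivEnd δ ^ (r - m) * (b • U)) := by
              rw [AddSubgroupClass.coe_sub, hQ, hXV, Subring.coe_mul, hd, mul_add, ← pow_add,
                Nat.sub_add_cancel (not_lt.1 hr), smul_add]
              abel
            rw [this]
            refine sub_mem hV (Submodule.smul_mem _ _ ?_)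
            have := pow_mul_mem_opFil hC (Submodule.smul_mem _ b hU) (r - m)
            rwa [Nat.sub_add_cancel (not_lt.1 hr)] at this
          have := add_mem h2 h1
          rwa [sub_add_cancel] at this
    intro X hX
    obtain ⟨r, hr⟩ := exists_mem_opFil (mem_opRing.1 X.2)
    exact key r X hX hr
  · rw [Ideal.span_singleton_le_iff_mem]
    exact I.mul_mem_left _ hTI

theorem opRing_isPrincipalIdealRing (hC : ∀ a ∈ C, δ a ∈ C)
    (hinv : ∀ a : C, a ≠ 0 → ∃ b : C, b * a = 1) : IsPrincipalIdealRing (opRing δ C hC) :=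
  ⟨fun I => ⟨let ⟨d, hd, _⟩ := exists_monic_generator hC hinv I; ⟨d, hd⟩⟩⟩

theorem opRing_isNoetherianRing (hC : ∀ a ∈ C, δ a ∈ C)
    (hinv : ∀ a : C, a ≠ 0 → ∃ b : C, b * a = 1) : IsNoetherianRing (opRing δ C hC) :=
  have := opRing_isPrincipalIdealRing hC hinv
  inferInstance

end Operators

/-! ### Modules and matrices over principal or Noetherian rings -/

section Matrices

/-- Over a principal left ideal ring, a submodule of `A ^ k` is spanned by `k` elements. -/
theorem exists_fin_generators {A : Type*} [Ring A] [IsPrincipalIdealRing A] (k : ℕ)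
    (N : Submodule A (Fin k → A)) :
    ∃ v : Fin k → Fin k → A, Submodule.span A (Set.range v) = N := by
  induction k with
  | zero => exact ⟨0, Subsingleton.elim _ _⟩
  | succ k ih =>
    -- The first coordinates of `N` form a principal left ideal. A lift `w` of its generator, with
    -- generators of the part of `N` having first coordinate `0`, spans `N`.
    obtain ⟨d, hd⟩ := (IsPrincipalIdealRing.principal (N.map (LinearMap.proj 0))).principal
    have hdm : d ∈ N.map (LinearMap.proj 0) := hd ▸ Submodule.mem_span_singleton_self d
    obtain ⟨w, hwN, hw⟩ := hdm
    change w 0 = d at hw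
    let ι : (Fin k → A) →ₗ[A] (Fin (k + 1) → A) :=
      { toFun := fun u => Fin.cons 0 u
        map_add' := fun u u' => by ext i; refine Fin.cases ?_ (fun i => ?_) i <;> simp
        map_smul' := fun a u => by ext i; refine Fin.cases ?_ (fun i => ?_) i <;> simp }
    obtain ⟨v, hv⟩ := ih (N.comap ι)
    refine ⟨Fin.cons w fun i => ι (v i), le_antisymm ?_ ?_⟩
    · rw [Submodule.span_le, Set.range_subset_iff]
      intro i
      refine Fin.cases ?_ (fun i => ?_) i
      · simpa using hwN
      · have : v i ∈ N.comap ι := hv ▸ Submodule.subset_span ⟨i, rfl⟩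
        simpa using this
    · intro x hx
      have hx0 : x 0 ∈ N.map (LinearMap.proj 0) := ⟨x, hx, rfl⟩
      rw [hd, Submodule.mem_span_singleton] at hx0
      obtain ⟨a, ha⟩ := hx0
      have hι : ι (fun i => (x - a • w) i.succ) = x - a • w := by
        ext i
        refine Fin.cases ?_ (fun i => ?_) i
        · simp [ι, ← ha, hw]
        · simp [ι]
      have h1 : (fun i => (x - a • w) i.succ) ∈ N.comap ι := by
        rw [Submodule.mem_comap, hι]
        exact sub_mem hx (N.smul_mem _ hwN)
      rw [← hv] at h1
      have h2 := Submodule.mem_map_of_mem (f := ι) h1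
      rw [hι, Submodule.map_span] at h2
      have h3 : x - a • w ∈ Submodule.span A (Set.range (Fin.cons w fun i => ι (v i) :
          Fin (k + 1) → Fin (k + 1) → A)) := by
        refine Submodule.span_mono ?_ h2
        rintro _ ⟨_, ⟨i, rfl⟩, rfl⟩
        exact ⟨i.succ, by simp⟩
      have h4 : a • w ∈ Submodule.span A (Set.range (Fin.cons w fun i => ι (v i) :
          Fin (k + 1) → Fin (k + 1) → A)) :=
        Submodule.smul_mem _ _ (Submodule.subset_span ⟨0, by simp⟩)
      have := add_mem h3 h4
      rwa [sub_add_cancel] at this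

/-- Over a left Noetherian ring, a `p × k` matrix with `p ≤ k` whose rows span is invertible. -/
theorem exists_inverse_of_span_eq_top {A : Type*} [Ring A] [IsNoetherianRing A] {p k : ℕ}
    (hpk : p ≤ k) (R : Matrix (Fin p) (Fin k) A) (h : Submodule.span A (Set.range R) = ⊤) :
    ∃ S : Matrix (Fin k) (Fin p) A, R * S = 1 ∧ S * R = 1 := by
  have hsum : ∀ v : Fin k → A, ∃ c : Fin p → A, ∑ i, c i • R i = v := fun v =>
    (Submodule.mem_span_range_iff_exists_fun A).1 (h ▸ Submodule.mem_top : v ∈ _)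
  choose c hc using hsum
  let S : Matrix (Fin k) (Fin p) A := fun j => c (Pi.single j 1)
  have hSR : S * R = 1 := by
    ext i j
    have := congrFun (hc (Pi.single i 1)) j
    rw [Matrix.mul_apply, Matrix.one_apply]
    simp only [Finset.sum_apply, Pi.smul_apply, smul_eq_mul, Pi.single_apply] at this
    simpa [S, eq_comm] using this
  refine ⟨S, ?_, hSR⟩
  let f : (Fin p → A) →ₗ[A] (Fin k → A) := Fintype.linearCombination A R
  let i : (Fin p → A) →ₗ[A] (Fin k → A) :=
    Function.ExtendByZero.linearMap A (Fin.castLE hpk)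
  have hi : Function.Injective i := by
    intro u v huv
    ext j
    have := congrFun huv (Fin.castLE hpk j)
    simpa [i, (Fin.castLE_injective hpk).extend_apply] using this
  have hf : Function.Surjective f := fun v =>
    ⟨c v, (Fintype.linearCombination_apply A R _).trans (hc v)⟩
  -- `f` maps `A ^ p` onto `A ^ k`, and padding by zeros embeds `A ^ p` in `A ^ k`; over a
  -- Noetherian ring this forces `f` to be injective. Then `R` can be cancelled on the right in `(R
  -- S) R = R`.
  have hinj := OrzechProperty.injective_of_surjective_of_injective i f hi hf
  have hRR : (R * S) * R = (1 : Matrix (Fin p) (Fin p) A) * R := by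
    rw [Matrix.mul_assoc, hSR, Matrix.mul_one, Matrix.one_mul]
  ext a b
  have : f ((R * S) a) = f ((1 : Matrix (Fin p) (Fin p) A) a) := by
    ext j
    have := congrFun (congrFun hRR a) j
    rw [Matrix.mul_apply, Matrix.mul_apply] at this
    simpa [f, Fintype.linearCombination_apply A R, Finset.sum_apply] using this
  exact congrFun (hinj this) b

/-- A proper submodule `N` of `A ^ k` is annihilated by some nonzero vector with entries in a given
left module, as soon as each proper left ideal annihilates a nonzero element of that module. -/
theorem exists_annihilated_vector {A X : Type*} [Ring A] [IsNoetherianRing A] [AddCommGroup X]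
    [Module A X] (Y : Set X) (hY : ∀ (a : A), ∀ x ∈ Y, a • x ∈ Y)
    (hX : ∀ I : Ideal A, I ≠ ⊤ → ∃ x ∈ Y, x ≠ 0 ∧ ∀ a ∈ I, a • x = 0) {k : ℕ}
    (N : Submodule A (Fin k → A)) (hN : N ≠ ⊤) :
    ∃ φ : Fin k → X, (∀ i, φ i ∈ Y) ∧ φ ≠ 0 ∧ ∀ v ∈ N, ∑ i, v i • φ i = 0 := by
  obtain ⟨N', hN', hle⟩ := (eq_top_or_exists_le_coatom N).resolve_left hN
  obtain ⟨j, hj⟩ : ∃ j, (Pi.single j 1 : Fin k → A) ∉ N' := by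
    by_contra! hcon
    refine hN'.1 (eq_top_iff.2 fun v _ => ?_)
    rw [pi_eq_sum_univ' v]
    refine sum_mem fun i _ => N'.smul_mem _ ?_
    convert hcon i using 1
  let e : Fin k → Fin k → A := fun i => Pi.single i 1
  -- The annihilator of the class of `e j`, which generates `A ^ k / N'` by maximality. With `e i ≡
  -- a i • e j`, sending `e i` to `a i • x` kills `N'`.
  let I : Ideal A := N'.comap (LinearMap.toSpanSingleton A (Fin k → A) (e j))
  have hI : ∀ a, a ∈ I ↔ a • e j ∈ N' := fun a => Iff.rfl
  obtain ⟨x, hxY, hx0, hx⟩ := hX I (by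
    rw [Ne, Ideal.eq_top_iff_one, hI, one_smul]
    exact hj)
  have htop : N' ⊔ Submodule.span A {e j} = ⊤ := hN'.2 _ (by
    refine lt_of_le_of_ne le_sup_left fun heq => hj ?_
    rw [heq]
    exact Submodule.mem_sup_right (Submodule.mem_span_singleton_self _))
  have hdec : ∀ i, ∃ a : A, e i - a • e j ∈ N' := by
    intro i
    have : e i ∈ N' ⊔ Submodule.span A {e j} := htop ▸ Submodule.mem_top
    obtain ⟨n, hn, z, hz, hnz⟩ := Submodule.mem_sup.1 this
    obtain ⟨a, rfl⟩ := Submodule.mem_span_singleton.1 hz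
    exact ⟨a, by rw [← hnz, add_sub_cancel_right]; exact hn⟩
  choose a ha using hdec
  refine ⟨fun i => a i • x, fun i => hY _ _ hxY, fun h0 => hx0 ?_, fun v hv => ?_⟩
  · have h1 : (1 - a j) ∈ I := by
      rw [hI, sub_smul, one_smul]
      exact ha j
    have h2 := hx _ h1
    have h3 : a j • x = 0 := congrFun h0 j
    rw [sub_smul, h3, one_smul, sub_zero] at h2
    exact h2
  · have h1 : ∑ i, v i * a i ∈ I := by
      rw [hI, Finset.sum_smul]
      have : ∑ i, (v i * a i) • e j = v - ∑ i, v i • (e i - a i • e j) := by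
        have hv' : v = ∑ i, v i • e i := by
          ext l
          simp [e, Finset.sum_apply, Pi.single_apply]
        simp only [smul_sub, Finset.sum_sub_distrib, smul_smul]
        rw [← hv']
        abel
      rw [this]
      exact sub_mem (hle hv) (sum_mem fun i _ => N'.smul_mem _ (ha i))
    have := hx _ h1
    simpa [Finset.sum_smul, mul_smul] using this

end Matrices

/-! ### Local solutions of linear differential equations -/

section LinearODE

/-- A monic homogeneous linear differential equation of positive order with smooth coefficients has
a smooth local solution that is not zero. -/
theorem exists_linear_ode_solution (n : ℕ) (c : Fin (n + 1) → ℝ → ℝ) (x₀ : ℝ)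
    (hc : ∀ i, ∀ᶠ x in 𝓝 x₀, ContDiffAt ℝ ∞ (c i) x) :
    ∃ ε > 0, ∃ u : ℝ → ℝ, ContDiffOn ℝ ∞ u (Set.Ioo (x₀ - ε) (x₀ + ε)) ∧ u x₀ = 1 ∧
      ∀ x ∈ Set.Ioo (x₀ - ε) (x₀ + ε),
        iteratedDeriv (n + 1) u x + ∑ i : Fin (n + 1), c i x * iteratedDeriv i u x = 0 := by
  -- The companion system, made autonomous by adding time as a first coordinate with derivative `1`.
  let v : ℝ × (Fin (n + 1) → ℝ) → ℝ × (Fin (n + 1) → ℝ) := fun p =>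
    (1, fun i => if h : (i : ℕ) + 1 < n + 1 then p.2 ⟨i + 1, h⟩ else -∑ j, c j p.1 * p.2 j)
  have hv : ∀ p : ℝ × (Fin (n + 1) → ℝ), (∀ i, ContDiffAt ℝ ∞ (c i) p.1) →
      ContDiffAt ℝ ∞ v p := by
    intro p hp
    have hcoord : ∀ j, ContDiffAt ℝ ∞ (fun q : ℝ × (Fin (n + 1) → ℝ) => q.2 j) p := fun j =>
      (contDiff_apply ℝ ℝ j).contDiffAt.comp p contDiffAt_snd
    refine contDiffAt_const.prodMk (contDiffAt_pi.2 fun i => ?_)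
    by_cases h : (i : ℕ) + 1 < n + 1
    · simpa only [h, dif_pos] using hcoord _
    · simp only [h, dif_neg, not_false_eq_true]
      exact (ContDiffAt.sum fun j _ =>
        (ContDiffAt.comp p (hp j) contDiffAt_fst).mul (hcoord j)).neg
  obtain ⟨ρ, hρ, hball⟩ := Metric.eventually_nhds_iff_ball.1 (eventually_all.2 hc)
  rw [Real.ball_eq_Ioo] at hball
  obtain ⟨α, hα0, ε, hε, hα⟩ :=
    ((hv (x₀, Pi.single 0 1) (hball x₀ ⟨by linarith, by linarith⟩)).of_le
      (by norm_num)).exists_forall_mem_closedBall_exists_eq_forall_mem_Ioo_hasDerivAt₀ x₀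
  have hx₀ : x₀ ∈ Set.Ioo (x₀ - ε) (x₀ + ε) := ⟨by linarith, by linarith⟩
  have hfst' : ∀ t ∈ Set.Ioo (x₀ - ε) (x₀ + ε), HasDerivAt (fun t => (α t).1 - t) 0 t := by
    intro t ht
    have h1 : HasDerivAt (fun t => (α t).1) 1 t := (hasFDerivAt_fst.comp_hasDerivAt t (hα t ht) :)
    have h2 := h1.sub (hasDerivAt_id' t)
    rw [sub_self] at h2
    exact h2
  have hfst : ∀ t ∈ Set.Ioo (x₀ - ε) (x₀ + ε), (α t).1 = t := by
    intro t ht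
    have := isOpen_Ioo.is_const_of_deriv_eq_zero isPreconnected_Ioo
      (fun s hs => (hfst' s hs).differentiableAt.differentiableWithinAt)
      (fun s hs => (hfst' s hs).deriv) ht hx₀
    simp only [hα0, sub_self] at this
    linarith
  have hsnd : ∀ i, ∀ t ∈ Set.Ioo (x₀ - ε) (x₀ + ε),
      HasDerivAt (fun t => (α t).2 i) ((v (α t)).2 i) t := fun i t ht =>
    hasDerivAt_pi.1 (hasFDerivAt_snd.comp_hasDerivAt t (hα t ht) :) i
  -- A closed interval on which both the system is solved and the coefficients are smooth, so that
  -- the solution inherits smoothness.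
  obtain ⟨η, hη, hηε, hηρ⟩ : ∃ η > 0, η < ε ∧ η < ρ :=
    ⟨min ε ρ / 2, by positivity, by linarith [min_le_left ε ρ, lt_min hε hρ],
      by linarith [min_le_right ε ρ, lt_min hε hρ]⟩
  have hsub : Set.Icc (x₀ - η) (x₀ + η) ⊆ Set.Ioo (x₀ - ε) (x₀ + ε) := fun t ht =>
    ⟨by linarith [ht.1], by linarith [ht.2]⟩
  have hsub' : Set.Icc (x₀ - η) (x₀ + η) ⊆ Set.Ioo (x₀ - ρ) (x₀ + ρ) := fun t ht =>
    ⟨by linarith [ht.1], by linarith [ht.2]⟩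
  have hsmooth : ContDiffOn ℝ ∞ α (Set.Icc (x₀ - η) (x₀ + η)) := by
    refine ODE.contDiffOn_enat_Icc_of_hasDerivWithinAt (f := fun _ => v) (n := ⊤)
      (u := {p | p.1 ∈ Set.Ioo (x₀ - ρ) (x₀ + ρ)}) ?_
      (fun t ht => (hα t (hsub ht)).hasDerivWithinAt) ?_
    · rintro ⟨t, p⟩ ⟨_, hp⟩
      exact (ContDiffAt.comp (t, p) (hv p (hball _ hp)) contDiffAt_snd).contDiffWithinAt
    · intro t ht
      rw [Set.mem_ofPred_eq, hfst t (hsub ht)]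
      exact hsub' ht
  have hiter : ∀ i (hi : i < n + 1), ∀ t ∈ Set.Ioo (x₀ - ε) (x₀ + ε),
      iteratedDeriv i (fun t => (α t).2 0) t = (α t).2 ⟨i, hi⟩ := by
    intro i
    induction i with
    | zero => intro _ t _; simp
    | succ i ih =>
      intro hi t ht
      have heq : iteratedDeriv i (fun t => (α t).2 0) =ᶠ[𝓝 t]
          fun t => (α t).2 ⟨i, by omega⟩ := by
        filter_upwards [isOpen_Ioo.mem_nhds ht] with s hs using ih _ s hs
      rw [iteratedDeriv_succ, heq.deriv_eq, (hsnd _ t ht).deriv]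
      simp only [v, hi, dif_pos]
  refine ⟨η, hη, fun t => (α t).2 0, ?_, by simp [hα0], ?_⟩
  · exact ((contDiff_apply ℝ ℝ (0 : Fin (n + 1))).comp contDiff_snd).comp_contDiffOn
      (hsmooth.mono Set.Ioo_subset_Icc_self)
  · intro t ht
    replace ht := hsub (Set.Ioo_subset_Icc_self ht)
    have heq : iteratedDeriv n (fun t => (α t).2 0) =ᶠ[𝓝 t]
        fun t => (α t).2 ⟨n, n.lt_succ_self⟩ := by
      filter_upwards [isOpen_Ioo.mem_nhds ht] with s hs using hiter n _ s hs
    rw [iteratedDeriv_succ, heq.deriv_eq, (hsnd _ t ht).deriv]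
    simp only [v, lt_irrefl, dif_neg, not_false_eq_true, hfst t ht]
    rw [neg_add_eq_zero]
    exact Finset.sum_congr rfl fun i _ => by rw [hiter i i.2 t ht]

end LinearODE

/-! ### Generic germs, functions of `x`, and local boxes -/

section Germs

variable {Ω : Opens (ℝ × ℝ)}

/-- `∂/∂x` of a function of two variables. -/
def xDeriv (f : ℝ × ℝ → ℝ) : ℝ × ℝ → ℝ := fun p => fderiv ℝ f p (1, 0)

theorem xDeriv_comp_fst (ψ : ℝ → ℝ) :
    xDeriv (fun q => ψ q.1) = fun q => deriv ψ q.1 := by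
  ext q
  by_cases h : DifferentiableAt ℝ ψ q.1
  · have := (h.hasFDerivAt.comp q hasFDerivAt_fst).fderiv
    change fderiv ℝ (ψ ∘ Prod.fst) q (1, 0) = _
    rw [this]
    simp
  -- Without differentiability both derivatives take the default value `0`.
  · have h' : ¬ DifferentiableAt ℝ (fun q : ℝ × ℝ => ψ q.1) q := fun h' => h (by
      have h2 : DifferentiableAt ℝ (fun x : ℝ => (x, q.2)) q.1 := by fun_prop
      exact DifferentiableAt.comp (g := fun q : ℝ × ℝ => ψ q.1) q.1 h' h2)
    simp [xDeriv, fderiv_zero_of_not_differentiableAt h', deriv_zero_of_not_differentiableAt h]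

theorem xDeriv_iterate_eventuallyEq {f : ℝ × ℝ → ℝ} {ψ : ℝ → ℝ} {p : ℝ × ℝ}
    (h : f =ᶠ[𝓝 p] fun q => ψ q.1) (n : ℕ) :
    xDeriv^[n] f =ᶠ[𝓝 p] fun q => iteratedDeriv n ψ q.1 := by
  induction n with
  | zero => simpa using h
  | succ n ih =>
    rw [Function.iterate_succ_apply', iteratedDeriv_succ]
    have : xDeriv (xDeriv^[n] f) =ᶠ[𝓝 p] xDeriv (fun q => iteratedDeriv n ψ q.1) :=
      ih.fderiv.mono fun q hq => congrArg (fun T : ℝ × ℝ →L[ℝ] ℝ => T (1, 0)) hq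
    rwa [xDeriv_comp_fst] at this

theorem coe_dx_pow {a : SmoothFun Ω} {f : ℝ × ℝ → ℝ} (h : (f : Germ (generic Ω) ℝ) = a) (n : ℕ) :
    (((dx.toLinearMap : Module.End ℤ (SmoothFun Ω)) ^ n) a : Germ (generic Ω) ℝ) =
      (xDeriv^[n] f : ℝ × ℝ → ℝ) := by
  induction n with
  | zero => simpa using h.symm
  | succ n ih =>
    rw [pow_succ', Function.iterate_succ_apply']
    change germDeriv (1, 0) ((((dx.toLinearMap : Module.End ℤ (SmoothFun Ω)) ^ n) a :
      SmoothFun Ω) : Germ (generic Ω) ℝ) = _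
    rw [ih]
    rfl

theorem eventually_mem_generic : ∀ᶠ p in generic Ω, p ∈ Ω := by
  change (Ω : Set (ℝ × ℝ)) ⊆ closure (interior (Ω : Set (ℝ × ℝ)))
  rw [Ω.isOpen.interior_eq]
  exact subset_closure

/-- The boundary of an open set is nowhere dense. This is why extension by zero costs nothing for
generic functions. -/
theorem eventually_mem_or_mem_interior_compl {U : Set (ℝ × ℝ)} (hU : IsOpen U) :
    ∀ᶠ p in generic Ω, p ∈ U ∨ p ∈ interior Uᶜ := by
  change (Ω : Set (ℝ × ℝ)) ⊆ closure (interior (U ∪ interior Uᶜ))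
  rw [(hU.union isOpen_interior).interior_eq, interior_compl, closure_union]
  intro p _
  by_cases h : p ∈ closure U
  · exact Or.inl h
  · exact Or.inr (subset_closure h)

theorem exists_mem_of_eventually_generic {U : Set (ℝ × ℝ)} (hU : IsOpen U) (hne : U.Nonempty)
    (hUΩ : U ⊆ Ω) {P : ℝ × ℝ → Prop} (h : ∀ᶠ p in generic Ω, P p) : ∃ p ∈ U, P p := by
  obtain ⟨p, hp⟩ := hne
  have h' : (Ω : Set (ℝ × ℝ)) ⊆ closure (interior {p | P p}) := h
  obtain ⟨q, hq, hq'⟩ := mem_closure_iff.1 (h' (hUΩ hp)) U hU hp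
  exact ⟨q, hq, interior_subset hq'⟩

/-- A smooth representative is constant on vertical segments of a small sup-norm ball; any other
representative agrees with it near a generic point. -/
theorem dependsOnlyOnX_of_dy_eq_zero {a : SmoothFun Ω} {f : ℝ × ℝ → ℝ}
    (hf : (f : Germ (generic Ω) ℝ) = a) (h : dy a = 0) :
    ∀ᶠ p in generic Ω, ∀ᶠ q in 𝓝 p, f q = f (q.1, p.2) := by
  obtain ⟨g, hg, hgs⟩ := a.2
  have h0 : ∀ᶠ p in generic Ω, fderiv ℝ g p (0, 1) = 0 := by
    have : germDeriv (0, 1) (a : Germ (generic Ω) ℝ) = ((fun _ => 0 : ℝ × ℝ → ℝ) :) :=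
      congrArg Subtype.val h
    rw [← hg] at this
    exact Germ.coe_eq.1 this
  have hfg : ∀ᶠ p in generic Ω, f p = g p := Germ.coe_eq.1 (hf.trans hg.symm)
  filter_upwards [generic_nhds h0, generic_nhds hgs, generic_nhds hfg] with p h1 h2 h3
  obtain ⟨ε, hε, hball⟩ := Metric.eventually_nhds_iff_ball.1 (h1.and (h2.and h3))
  filter_upwards [Metric.ball_mem_nhds p hε] with q hq
  rw [Metric.mem_ball, Prod.dist_eq, max_lt_iff] at hq
  have hmem : ∀ y ∈ Metric.ball p.2 ε, (q.1, y) ∈ Metric.ball p ε := fun y hy => by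
    rw [Metric.mem_ball, Prod.dist_eq, max_lt_iff]
    exact ⟨hq.1, hy⟩
  have hd : ∀ y ∈ Metric.ball p.2 ε, HasDerivAt (fun y => g (q.1, y)) 0 y := by
    intro y hy
    obtain ⟨e1, e2, _⟩ := hball _ (hmem y hy)
    have := (e2.differentiableAt (by simp)).hasFDerivAt.comp_hasDerivAt y
      ((hasDerivAt_const y q.1).prodMk (hasDerivAt_id y))
    rwa [e1] at this
  have hq2 : q.2 ∈ Metric.ball p.2 ε := hq.2
  have hp2 : p.2 ∈ Metric.ball p.2 ε := Metric.mem_ball_self hε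
  have := Metric.isOpen_ball.is_const_of_deriv_eq_zero (convex_ball p.2 ε).isPreconnected
    (fun s hs => (hd s hs).differentiableAt.differentiableWithinAt)
    (fun s hs => (hd s hs).deriv) hq2 hp2
  rw [(hball _ (hmem p.2 hp2)).2.2, ← this]
  exact (hball _ (hmem q.2 hq2)).2.2

theorem dependsOnlyOnX_iff {a : SmoothFun Ω} : DependsOnlyOnX a ↔ dy a = 0 := by
  constructor
  · rintro ⟨f, hf, hfx⟩
    obtain ⟨g, hg, hgs⟩ := a.2
    refine Subtype.ext ?_
    change germDeriv (0, 1) (a : Germ (generic Ω) ℝ) = ((fun _ => 0 : ℝ × ℝ → ℝ) :)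
    rw [← hf]
    refine Germ.coe_eq.2 ?_
    have hfg : ∀ᶠ p in generic Ω, f p = g p := Germ.coe_eq.1 (hf.trans hg.symm)
    filter_upwards [hfx, hgs, generic_nhds hfg] with p h1 h2 h3
    have hdiff : DifferentiableAt ℝ f p :=
      (h2.differentiableAt (by simp)).congr_of_eventuallyEq h3
    have hline : HasDerivAt (fun y : ℝ => (p.1, y)) (0, 1) p.2 :=
      (hasDerivAt_const p.2 p.1).prodMk (hasDerivAt_id p.2)
    have h4 : HasDerivAt (fun y => f (p.1, y)) (fderiv ℝ f p (0, 1)) p.2 :=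
      HasFDerivAt.comp_hasDerivAt (f := fun y : ℝ => (p.1, y)) p.2 hdiff.hasFDerivAt hline
    have h5 : (fun y => f (p.1, y)) =ᶠ[𝓝 p.2] fun _ => f (p.1, p.2) :=
      hline.continuousAt.eventually h1
    exact h4.unique ((hasDerivAt_const _ _).congr_of_eventuallyEq h5)
  · intro h
    obtain ⟨f, hf, _⟩ := a.2
    exact ⟨f, hf, dependsOnlyOnX_of_dy_eq_zero hf h⟩

theorem dx_dy_comm (a : SmoothFun Ω) : dy (dx a) = dx (dy a) := by
  obtain ⟨a, f, rfl, hf⟩ := a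
  refine Subtype.ext (Germ.coe_eq.2 ?_)
  filter_upwards [hf] with p hp
  have hd : DifferentiableAt ℝ (fderiv ℝ f) p :=
    (hp.fderiv_right (m := ∞) (by simp)).differentiableAt (by simp)
  have hs : IsSymmSndFDerivAt ℝ f p := hp.isSymmSndFDerivAt (by
    rw [minSmoothness_of_isRCLikeNormedField]
    exact WithTop.coe_le_coe.2 (le_top : (2 : ℕ∞) ≤ ⊤))
  have key : ∀ v w : ℝ × ℝ, fderiv ℝ (fun q => fderiv ℝ f q v) p w = fderiv ℝ (fderiv ℝ f) p w v :=
    fun v w => by rw [fderiv_clm_apply hd (differentiableAt_const v)]; simp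
  rw [key, key, hs.eq]

theorem toEnd_apply (P : DiffOp Ω) (a : SmoothFun Ω) :
    P.toEnd a = ∑ n ∈ P.support, P n * ((dx.toLinearMap : Module.End ℤ (SmoothFun Ω)) ^ n) a := by
  simp [DiffOp.toEnd, Finsupp.sum, LinearMap.sum_apply]

theorem coe_sum_toEnd {k : ℕ} {L : Fin k → DiffOp Ω} {l : Fin k → ℕ → ℝ × ℝ → ℝ}
    (hl : ∀ i n, (l i n : Germ (generic Ω) ℝ) = L i n) {φ : Fin k → SmoothFun Ω}
    {f : Fin k → ℝ × ℝ → ℝ} (hf : ∀ i, (f i : Germ (generic Ω) ℝ) = φ i) :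
    ((∑ i, (L i).toEnd (φ i) : SmoothFun Ω) : Germ (generic Ω) ℝ) =
      ((fun p => ∑ i, ∑ n ∈ (L i).support, l i n p * (xDeriv^[n] (f i)) p : ℝ × ℝ → ℝ) :) := by
  have : (fun p => ∑ i, ∑ n ∈ (L i).support, l i n p * (xDeriv^[n] (f i)) p) =
      ∑ i, ∑ n ∈ (L i).support, l i n * (xDeriv^[n] (f i)) := by
    ext p
    simp
  rw [this]
  change _ = Germ.coeRingHom (generic Ω) _
  rw [map_sum, AddSubmonoidClass.coe_finsetSum]
  refine Finset.sum_congr rfl fun i _ => ?_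
  rw [map_sum, toEnd_apply, AddSubmonoidClass.coe_finsetSum]
  refine Finset.sum_congr rfl fun n _ => ?_
  rw [map_mul, Subring.coe_mul, coe_dx_pow (hf i), ← hl]
  rfl

/-- The function `φ(x)` on the open set `U`, extended by zero. -/
def extendX (U : Set (ℝ × ℝ)) (φ : ℝ → ℝ) : ℝ × ℝ → ℝ := U.indicator fun p => φ p.1

theorem extendX_eventuallyEq {U : Set (ℝ × ℝ)} (hU : IsOpen U) (φ : ℝ → ℝ) {p : ℝ × ℝ}
    (hp : p ∈ U) : extendX U φ =ᶠ[𝓝 p] fun q => φ q.1 := by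
  filter_upwards [hU.mem_nhds hp] with q hq using Set.indicator_of_mem hq _

theorem extendX_eventuallyEq_zero {U : Set (ℝ × ℝ)} (φ : ℝ → ℝ) {p : ℝ × ℝ}
    (hp : p ∈ interior Uᶜ) : extendX U φ =ᶠ[𝓝 p] fun q => (fun _ => (0 : ℝ)) q.1 := by
  filter_upwards [mem_interior_iff_mem_nhds.1 hp] with q hq using Set.indicator_of_notMem hq _

theorem extendX_mem {U : Set (ℝ × ℝ)} (hU : IsOpen U) {φ : ℝ → ℝ}
    (hφ : ∀ p ∈ U, ContDiffAt ℝ ∞ φ p.1) :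
    (extendX U φ : Germ (generic Ω) ℝ) ∈ SmoothFun Ω := by
  refine ⟨_, rfl, ?_⟩
  filter_upwards [eventually_mem_or_mem_interior_compl hU] with p hp
  rcases hp with hp | hp
  · exact (ContDiffAt.comp p (hφ p hp) contDiffAt_fst).congr_of_eventuallyEq
      (extendX_eventuallyEq hU φ hp)
  · exact contDiffAt_const.congr_of_eventuallyEq (extendX_eventuallyEq_zero φ hp)

theorem dy_extendX {U : Set (ℝ × ℝ)} (hU : IsOpen U) {φ : ℝ → ℝ}
    (hφ : ∀ p ∈ U, ContDiffAt ℝ ∞ φ p.1) :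
    dy (⟨extendX U φ, extendX_mem hU hφ⟩ : SmoothFun Ω) = 0 := by
  refine Subtype.ext (Germ.coe_eq.2 ?_)
  filter_upwards [eventually_mem_or_mem_interior_compl hU] with p hp
  rcases hp with hp | hp
  · rw [(extendX_eventuallyEq hU φ hp).fderiv_eq]
    have := ((hφ p hp).differentiableAt (by simp)).hasFDerivAt.comp p hasFDerivAt_fst
    change fderiv ℝ (φ ∘ Prod.fst) p (0, 1) = 0
    rw [this.fderiv]
    simp
  · rw [(extendX_eventuallyEq_zero φ hp).fderiv_eq]
    simp

theorem extendX_ne_zero {U : Set (ℝ × ℝ)} (hU : IsOpen U) (hUΩ : U ⊆ Ω) {φ : ℝ → ℝ}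
    (hφ : ∀ p ∈ U, ContDiffAt ℝ ∞ φ p.1) {p : ℝ × ℝ} (hp : p ∈ U) (hp0 : φ p.1 ≠ 0) :
    (⟨extendX U φ, extendX_mem hU hφ⟩ : SmoothFun Ω) ≠ 0 := by
  intro h0
  have h1 : ∀ᶠ q in generic Ω, extendX U φ q = 0 := Germ.coe_eq.1 (congrArg Subtype.val h0)
  have h2 : ∀ᶠ q in 𝓝 p, φ q.1 ≠ 0 :=
    ((hφ p hp).continuousAt.comp continuousAt_fst).eventually_ne hp0
  obtain ⟨W, hW, hWo, hpW⟩ := eventually_nhds_iff.1 h2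
  obtain ⟨q, hq, hq0⟩ := exists_mem_of_eventually_generic (hWo.inter hU) ⟨p, hpW, hp⟩
    (Set.inter_subset_right.trans hUΩ) h1
  rw [extendX, Set.indicator_of_mem hq.2] at hq0
  exact hW q hq.1 hq0

theorem isOpen_box (a b c d : ℝ) : IsOpen (Set.Ioo a b ×ˢ Set.Ioo c d) := isOpen_Ioo.prod isOpen_Ioo

theorem exists_box {P : ℝ × ℝ → Prop} {p : ℝ × ℝ} (h : ∀ᶠ q in 𝓝 p, P q) :
    ∃ ε > 0, ∀ q ∈ Set.Ioo (p.1 - ε) (p.1 + ε) ×ˢ Set.Ioo (p.2 - ε) (p.2 + ε), P q := by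
  obtain ⟨ε, hε, hball⟩ := Metric.eventually_nhds_iff_ball.1 h
  refine ⟨ε, hε, fun q hq => hball q ?_⟩
  rwa [← Real.ball_eq_Ioo, ← Real.ball_eq_Ioo, ball_prod_same] at hq

/-- Kernel reducibility means that the row annihilates a nonzero vector of functions of `x`. -/
theorem isKernelReducible_iff {k : ℕ} (L : Fin k → DiffOp Ω) :
    IsKernelReducible L ↔ ∃ φ : Fin k → SmoothFun Ω, (∀ i, dy (φ i) = 0) ∧ φ ≠ 0 ∧
      ∑ i, (L i).toEnd (φ i) = 0 := by
  constructor
  · rintro ⟨a, b, c, d, hab, hcd, hΩ, l, hl, -, φ, hφ, ⟨i₀, x₀, hx₀, hne⟩, hsum⟩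
    have hU := isOpen_box a b c d
    have hφ' : ∀ i, ∀ p ∈ Set.Ioo a b ×ˢ Set.Ioo c d, ContDiffAt ℝ ∞ (φ i) p.1 := fun i p hp =>
      (hφ i).contDiffAt (isOpen_Ioo.mem_nhds hp.1)
    obtain ⟨y₀, hy₀⟩ := Set.nonempty_Ioo.2 hcd
    refine ⟨fun i => ⟨_, extendX_mem hU (hφ' i)⟩, fun i => dy_extendX hU (hφ' i),
      fun h0 => extendX_ne_zero hU hΩ (hφ' i₀) (p := (x₀, y₀)) ⟨hx₀, hy₀⟩ hne (congrFun h0 i₀), ?_⟩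
    refine Subtype.ext ?_
    rw [coe_sum_toEnd hl (f := fun i => extendX (Set.Ioo a b ×ˢ Set.Ioo c d) (φ i)) fun i => rfl]
    refine Germ.coe_eq.2 ?_
    filter_upwards [eventually_mem_or_mem_interior_compl hU] with p hp
    rcases hp with hp | hp
    · rw [← hsum p.1 hp.1 p.2 hp.2]
      refine Finset.sum_congr rfl fun i _ => Finset.sum_congr rfl fun n _ => ?_
      rw [(xDeriv_iterate_eventuallyEq (extendX_eventuallyEq hU (φ i) hp) n).eq_of_nhds]
    · refine Finset.sum_eq_zero fun i _ => Finset.sum_eq_zero fun n _ => ?_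
      rw [(xDeriv_iterate_eventuallyEq (ψ := fun _ => 0)
        (extendX_eventuallyEq_zero (φ i) hp) n).eq_of_nhds]
      simp
  · rintro ⟨φ, hφ, hne, hsum⟩
    choose l hl hls using fun i n => (L i n).2
    choose f hf hfs using fun i => (φ i).2
    obtain ⟨i₀, hi₀⟩ := Function.ne_iff.1 hne
    have hfreq : ∃ᶠ p in generic Ω, f i₀ p ≠ 0 := by
      intro hcon
      refine hi₀ (Subtype.ext ?_)
      rw [← hf]
      exact Germ.coe_eq.2 (hcon.mono fun p hp => not_not.1 hp)
    have hzero : ∀ᶠ p in generic Ω,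
        ∑ i, ∑ n ∈ (L i).support, l i n p * (xDeriv^[n] (f i)) p = 0 := by
      have := congrArg Subtype.val hsum
      rw [coe_sum_toEnd hl hf] at this
      exact Germ.coe_eq.1 this
    have hlsmooth : ∀ᶠ p in generic Ω, ∀ i, ∀ n ∈ (L i).support, ContDiffAt ℝ ∞ (l i n) p :=
      eventually_all.2 fun i => (Finset.eventually_all _).2 fun n _ => hls i n
    -- One point where some `φ i` is nonzero and near which all generic conditions hold; the box is
    -- taken around it.
    obtain ⟨p, hp0, h1, h2, h3, h4, h5⟩ := (hfreq.and_eventually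
      ((generic_nhds eventually_mem_generic).and ((generic_nhds hzero).and
      ((generic_nhds hlsmooth).and ((generic_nhds (eventually_all.2 hfs)).and
      (eventually_all.2 fun i => dependsOnlyOnX_of_dy_eq_zero (hf i) (hφ i))))))).exists
    obtain ⟨ε, hε, hbox⟩ := exists_box (h1.and (h2.and (h3.and (h4.and
      (eventually_eventually_nhds.2 (eventually_all.2 h5))))))
    have hp2 : p.2 ∈ Set.Ioo (p.2 - ε) (p.2 + ε) := ⟨by linarith, by linarith⟩
    classical
    -- Smoothness on the box is secured only for the finitely many `n` in the support; elsewhere the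
    -- coefficient is represented by `0`.
    refine ⟨p.1 - ε, p.1 + ε, p.2 - ε, p.2 + ε, by linarith, by linarith,
      fun q hq => (hbox q hq).1, fun i n => if n ∈ (L i).support then l i n else 0, ?_, ?_,
      fun i x => f i (x, p.2), ?_, ⟨i₀, p.1, ⟨by linarith, by linarith⟩, hp0⟩, ?_⟩
    · intro i n
      by_cases hn : n ∈ (L i).support
      · simp only [hn, if_true, hl]
      · simp only [hn, if_false]
        rw [Finsupp.notMem_support_iff.1 hn]
        rfl
    · intro i n q hq
      by_cases hn : n ∈ (L i).support
      · simp only [hn, if_true]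
        exact ((hbox q hq).2.2.1 i n hn).contDiffWithinAt
      · simp only [hn, if_false]
        exact contDiffWithinAt_const
    · intro i x hx
      have := (hbox (x, p.2) ⟨hx, hp2⟩).2.2.2.1 i
      exact (ContDiffAt.comp x this (contDiffAt_id.prodMk contDiffAt_const)).contDiffWithinAt
    · intro x hx y hy
      obtain ⟨-, e1, -, -, e2⟩ := hbox (x, y) ⟨hx, hy⟩
      rw [← e1]
      refine Finset.sum_congr rfl fun i _ => Finset.sum_congr rfl fun n hn => ?_
      have hfi : f i =ᶠ[𝓝 (x, y)] fun q => (fun x => f i (x, p.2)) q.1 := e2.mono fun q hq => hq i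
      rw [(xDeriv_iterate_eventuallyEq (ψ := fun x => f i (x, p.2)) hfi n).eq_of_nhds]
      simp only [hn, if_true]

end Germs

/-! ### Functions of `x` inside `K`, and the two implications -/

variable {Ω : Opens (ℝ × ℝ)}

theorem mem_opSpan_iff {C : Subring (SmoothFun Ω)} {T : Module.End ℤ (SmoothFun Ω)} :
    T ∈ opSpan dx C ↔ ∃ P : DiffOp Ω, (∀ n, P n ∈ C) ∧ P.toEnd = T := by
  constructor
  · intro hT
    obtain ⟨c, rfl⟩ := Finsupp.mem_span_range_iff_exists_finsupp.1 hT
    refine ⟨c.mapRange Subtype.val rfl, fun n => by simp, ?_⟩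
    rw [DiffOp.toEnd, Finsupp.sum_mapRange_index]
    · rfl
    · intro n
      simp
  · rintro ⟨P, hP, rfl⟩
    exact sum_mem fun n _ => Submodule.smul_mem _ (⟨P n, hP n⟩ : C)
      (Submodule.subset_span ⟨n, rfl⟩)

theorem opSpan_mono {C C' : Subring (SmoothFun Ω)} (h : C ≤ C') {T : Module.End ℤ (SmoothFun Ω)}
    (hT : T ∈ opSpan dx C) : T ∈ opSpan dx C' := by
  obtain ⟨P, hP, rfl⟩ := mem_opSpan_iff.1 hT
  exact mem_opSpan_iff.2 ⟨P, fun n => h (hP n), rfl⟩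

/-- The elements of `K` that depend on `x` only. -/
def xConst (K : Subring (SmoothFun Ω)) : Subring (SmoothFun Ω) where
  carrier := {a | a ∈ K ∧ dy a = 0}
  zero_mem' := ⟨zero_mem _, map_zero _⟩
  one_mem' := ⟨one_mem _, dy.map_one_eq_zero⟩
  add_mem' := fun ha hb => ⟨add_mem ha.1 hb.1, by rw [map_add, ha.2, hb.2, add_zero]⟩
  neg_mem' := fun ha => ⟨neg_mem ha.1, by rw [map_neg, ha.2, neg_zero]⟩
  mul_mem' := fun ha hb => ⟨mul_mem ha.1 hb.1, by
    rw [Derivation.leibniz, ha.2, hb.2, smul_zero, smul_zero, add_zero]⟩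

theorem isX_iff {K : Subring (SmoothFun Ω)} {P : DiffOp Ω} : P.IsX K ↔ ∀ n, P n ∈ xConst K :=
  forall_congr' fun _ => and_congr_right fun _ => dependsOnlyOnX_iff

section Field

variable {K : Subring (SmoothFun Ω)} (hK : IsDifferentialField K)
include hK

theorem exists_inv_mem {a : SmoothFun Ω} (ha : a ∈ K) (h0 : a ≠ 0) : ∃ b ∈ K, b * a = 1 := by
  obtain ⟨b, hb⟩ := hK.isField.mul_inv_cancel (a := ⟨a, ha⟩) (fun h => h0 (congrArg Subtype.val h))
  exact ⟨b, b.2, by rw [mul_comm]; exact congrArg Subtype.val hb⟩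

theorem smoothFun_one_ne_zero : (1 : SmoothFun Ω) ≠ 0 := by
  obtain ⟨x, y, hxy⟩ := hK.isField.exists_pair_ne
  intro h
  refine hxy (Subtype.ext ?_)
  rw [← one_mul (x : SmoothFun Ω), ← one_mul (y : SmoothFun Ω), h, zero_mul, zero_mul]

theorem dx_mem_xConst : ∀ a ∈ xConst K, dx a ∈ xConst K := fun a ha =>
  ⟨hK.dx_mem a ha.1, by rw [dx_dy_comm, ha.2, map_zero]⟩

theorem exists_inv_xConst (a : xConst K) (h0 : a ≠ 0) : ∃ b : xConst K, b * a = 1 := by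
  obtain ⟨b, hb, hba⟩ := exists_inv_mem hK a.2.1 (fun h => h0 (Subtype.ext h))
  refine ⟨⟨b, hb, ?_⟩, Subtype.ext hba⟩
  have h1 := congrArg dy hba
  rw [Derivation.leibniz, a.2.2, smul_zero, zero_add, dy.map_one_eq_zero, smul_eq_mul] at h1
  calc dy b = b * a * dy b := by rw [hba, one_mul]
    _ = 0 := by rw [mul_assoc, h1, mul_zero]

theorem xConst_isField : IsField (xConst K) where
  exists_pair_ne := ⟨1, 0, fun h => smoothFun_one_ne_zero hK (congrArg Subtype.val h)⟩
  mul_comm := mul_comm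
  mul_inv_cancel := fun {a} h =>
    let ⟨b, hb⟩ := exists_inv_xConst hK a h
    ⟨b, by rw [mul_comm, hb]⟩

/-- Elements of `K` that are independent over the functions of `x` in `K` are independent over all
functions of `x`. -/
theorem eq_zero_of_sum_mul_eq_zero (m : ℕ) (e : Fin m → SmoothFun Ω) (he : ∀ i, e i ∈ K)
    (hli : ∀ c : Fin m → SmoothFun Ω, (∀ i, c i ∈ xConst K) → ∑ i, e i * c i = 0 → c = 0)
    (u : Fin m → SmoothFun Ω) (hu : ∀ i, dy (u i) = 0) (h : ∑ i, e i * u i = 0) : u = 0 := by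
  induction m with
  | zero => exact Subsingleton.elim _ _
  | succ m ih =>
    have h0 : e 0 ≠ 0 := by
      intro h0
      have := hli (Pi.single 0 1) (fun i => by
        by_cases hi : i = 0
        · subst hi; simp
        · simp [hi]) (by simp [Pi.single_apply, h0])
      exact smoothFun_one_ne_zero hK (by simpa using congrFun this 0)
    obtain ⟨b, hb, hb0⟩ := exists_inv_mem hK (he 0) h0
    have hnorm : ∀ w : Fin (m + 1) → SmoothFun Ω,
        b * ∑ i, e i * w i = w 0 + ∑ i : Fin m, (b * e i.succ) * w i.succ := by
      intro w
      rw [Fin.sum_univ_succ, mul_add, ← mul_assoc, hb0, one_mul, Finset.mul_sum]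
      simp only [mul_assoc]
    have hdiff : ∀ w : Fin m → SmoothFun Ω, (∀ i, dy (w i) = 0) →
        dy (∑ i : Fin m, (b * e i.succ) * w i) = ∑ i : Fin m, dy (b * e i.succ) * w i := by
      intro w hw
      rw [map_sum]
      refine Finset.sum_congr rfl fun i _ => ?_
      rw [Derivation.leibniz, hw, smul_zero, zero_add, smul_eq_mul, mul_comm]
    have htail : (fun i : Fin m => u i.succ) = 0 := by
      -- Dividing by `e 0` and applying `dy` removes the first term. The new family is again
      -- independent over `xConst K`: if `∑ dy (b e_i) c_i = 0`, then `∑ b e_i c_i` itself lies in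
      -- `xConst K`, and moving it to the first place gives a relation among the old `e`.
      refine ih (fun i => dy (b * e i.succ)) (fun i => hK.dy_mem _ (mul_mem hb (he _))) ?_ _
        (fun i => hu _) ?_
      · intro c hc hsum
        have hs : dy (∑ i : Fin m, (b * e i.succ) * c i) = 0 := by
          rw [hdiff c fun i => (hc i).2, hsum]
        have hsK : ∑ i : Fin m, (b * e i.succ) * c i ∈ K :=
          sum_mem fun i _ => mul_mem (mul_mem hb (he _)) (hc i).1
        have hc' := hli (Fin.cons (-∑ i : Fin m, (b * e i.succ) * c i) c)
          (fun i => Fin.cases ⟨neg_mem hsK, by simp [hs]⟩ (fun i => by simpa using hc i) i) (by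
            have h1 := hnorm (Fin.cons (-∑ i : Fin m, (b * e i.succ) * c i) c)
            simp only [Fin.cons_zero, Fin.cons_succ, neg_add_cancel] at h1
            have h2 := congrArg (e 0 * ·) h1
            simp only [← mul_assoc, mul_comm (e 0) b, hb0, one_mul, mul_zero] at h2
            exact h2)
        ext1 i
        simpa using congrFun hc' i.succ
      · have h1 := hnorm u
        rw [h, mul_zero] at h1
        have h2 := congrArg dy h1
        rw [map_add, hu, zero_add, map_zero, hdiff (fun i => u i.succ) fun i => hu _] at h2
        exact h2.symm
    have h1 := hnorm u
    rw [h, mul_zero] at h1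
    have h3 : u 0 = 0 := by
      rw [eq_comm, Finset.sum_eq_zero, add_zero] at h1
      · exact h1
      · intro i _
        have : u i.succ = 0 := congrFun htail i
        rw [this, mul_zero]
    ext1 i
    exact Fin.cases h3 (fun i => congrFun htail i) i

omit hK in
theorem dy_apply_eq_zero {T : Module.End ℤ (SmoothFun Ω)} (hT : T ∈ opSpan dx (xConst K))
    {a : SmoothFun Ω} (ha : dy a = 0) : dy (T a) = 0 := by
  induction hT using Submodule.span_induction with
  | mem x hx =>
    obtain ⟨i, rfl⟩ := hx
    induction i with
    | zero => simpa using ha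
    | succ i ih =>
      simp only [pow_succ'] at ih ⊢
      exact (dx_dy_comm _).trans (by rw [ih, map_zero])
  | zero => simp
  | add x y _ _ hx hy => rw [LinearMap.add_apply, map_add, hx, hy, add_zero]
  | smul c x _ hx =>
    rw [LinearMap.smul_apply, Subring.smul_def, smul_eq_mul, Derivation.leibniz, hx, c.2.2,
      smul_zero, smul_zero, add_zero]

omit hK in
theorem exists_eq_sum_of_mem_opFil {n : ℕ} {C : Subring (SmoothFun Ω)}
    {U : Module.End ℤ (SmoothFun Ω)} (hU : U ∈ opFil dx C n) :
    ∃ c : Fin n → C, U = ∑ i, c i • derivEnd dx ^ (i : ℕ) := by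
  have : (fun i => (derivEnd dx : Module.End ℤ (SmoothFun Ω)) ^ i) '' Set.Iio n =
      Set.range fun i : Fin n => derivEnd dx ^ (i : ℕ) := by
    ext T
    constructor
    · rintro ⟨i, hi, rfl⟩
      exact ⟨⟨i, hi⟩, rfl⟩
    · rintro ⟨i, rfl⟩
      exact ⟨i, i.2, rfl⟩
  rw [opFil, this, Submodule.mem_span_range_iff_exists_fun] at hU
  obtain ⟨c, hc⟩ := hU
  exact ⟨c, hc.symm⟩

/-- A monic operator in `x` of positive order annihilates a nonzero function of `x`. -/
theorem exists_annihilated_of_monic {m : ℕ} {U : Module.End ℤ (SmoothFun Ω)}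
    (hU : U ∈ opFil dx (xConst K) (m + 1)) :
    ∃ φ : SmoothFun Ω, dy φ = 0 ∧ φ ≠ 0 ∧
      (derivEnd dx ^ (m + 1) + U : Module.End ℤ (SmoothFun Ω)) φ = 0 := by
  obtain ⟨c, rfl⟩ := exists_eq_sum_of_mem_opFil hU
  choose g hg hgs using fun i => (c i : SmoothFun Ω).2
  have hne : ∃ᶠ _ in generic Ω, True := by
    intro h
    exact smoothFun_one_ne_zero hK (Subtype.ext (Germ.coe_eq.2 (h.mono fun p hp => (hp trivial).elim)))
  obtain ⟨p, -, h1, h2, h3⟩ := (hne.and_eventually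
      ((generic_nhds eventually_mem_generic).and ((generic_nhds (eventually_all.2 hgs)).and
      (eventually_all.2 fun i => dependsOnlyOnX_of_dy_eq_zero (hg i) (c i).2.2)))).exists
  obtain ⟨ε, hε, hbox⟩ := exists_box (h1.and (h2.and (eventually_all.2 h3)))
  have hp2 : p.2 ∈ Set.Ioo (p.2 - ε) (p.2 + ε) := ⟨by linarith, by linarith⟩
  -- On the box the coefficients do not vary with `y`, so freezing `y = p.2` leaves an ordinary
  -- equation in `x`.
  obtain ⟨ε', hε', u, hu, hu0, hode⟩ := exists_linear_ode_solution m (fun i x => g i (x, p.2)) p.1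
    (fun i => by
      filter_upwards [Ioo_mem_nhds (show p.1 - ε < p.1 by linarith)
        (show p.1 < p.1 + ε by linarith)] with x hx
      exact ContDiffAt.comp (g := g i) x ((hbox (x, p.2) ⟨hx, hp2⟩).2.1 i)
        (contDiffAt_id.prodMk contDiffAt_const))
  let V : Set (ℝ × ℝ) := (Set.Ioo (p.1 - ε) (p.1 + ε) ×ˢ Set.Ioo (p.2 - ε) (p.2 + ε)) ∩
    Prod.fst ⁻¹' Set.Ioo (p.1 - ε') (p.1 + ε')
  have hV : IsOpen V := (isOpen_box _ _ _ _).inter (isOpen_Ioo.preimage continuous_fst)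
  have hpV : p ∈ V :=
    ⟨⟨⟨by linarith, by linarith⟩, hp2⟩, ⟨by linarith, by linarith⟩⟩
  have huV : ∀ q ∈ V, ContDiffAt ℝ ∞ u q.1 := fun q hq => hu.contDiffAt (isOpen_Ioo.mem_nhds hq.2)
  refine ⟨⟨extendX V u, extendX_mem hV huV⟩, dy_extendX hV huV,
    extendX_ne_zero hV (fun q hq => (hbox q hq.1).1) huV hpV (by rw [hu0]; exact one_ne_zero), ?_⟩
  refine Subtype.ext ?_
  have hcoe : (((derivEnd dx ^ (m + 1) + ∑ i, c i • derivEnd dx ^ (i : ℕ) :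
      Module.End ℤ (SmoothFun Ω)) (⟨extendX V u, extendX_mem hV huV⟩ : SmoothFun Ω) : SmoothFun Ω) :
      Germ (generic Ω) ℝ) =
      ((xDeriv^[m + 1] (extendX V u) + ∑ i, g i * xDeriv^[i] (extendX V u) : ℝ × ℝ → ℝ) :) := by
    change _ = Germ.coeRingHom (generic Ω) _
    rw [map_add, map_sum, LinearMap.add_apply, LinearMap.sum_apply, Subring.coe_add,
      AddSubmonoidClass.coe_finsetSum, coe_dx_pow rfl]
    refine congrArg₂ _ rfl (Finset.sum_congr rfl fun i _ => ?_)
    rw [map_mul, LinearMap.smul_apply, Subring.smul_def, smul_eq_mul, Subring.coe_mul,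
      coe_dx_pow rfl, ← hg]
    rfl
  rw [hcoe]
  refine Germ.coe_eq.2 ?_
  filter_upwards [eventually_mem_or_mem_interior_compl hV] with q hq
  simp only [Pi.add_apply, Finset.sum_apply, Pi.mul_apply]
  rcases hq with hq | hq
  · have hq' := hode q.1 hq.2
    rw [(xDeriv_iterate_eventuallyEq (extendX_eventuallyEq hV u hq) _).eq_of_nhds, ← hq']
    refine congrArg₂ _ rfl (Finset.sum_congr rfl fun i _ => ?_)
    rw [(xDeriv_iterate_eventuallyEq (extendX_eventuallyEq hV u hq) _).eq_of_nhds,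
      (hbox q hq.1).2.2 i]
  · have hz : ∀ n, (xDeriv^[n] (extendX V u)) q = 0 := fun n => by
      rw [(xDeriv_iterate_eventuallyEq (ψ := fun _ => 0) (extendX_eventuallyEq_zero u hq)
        n).eq_of_nhds]
      simp
    simp [hz]

/-- A function killed by the generator is killed by `I`. Generator `0` allows the function `1`; a
monic generator of order `0` would be `1`, excluded as `I` is proper; positive order is the ODE
case. -/
theorem exists_annihilated_of_ne_top (I : Ideal (opRing dx (xConst K) (dx_mem_xConst hK)))
    (hI : I ≠ ⊤) :
    ∃ φ ∈ {a : SmoothFun Ω | dy a = 0}, φ ≠ 0 ∧ ∀ T ∈ I, T • φ = 0 := by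
  obtain ⟨d, rfl, hd⟩ := exists_monic_generator (dx_mem_xConst hK) (exists_inv_xConst hK) I
  obtain ⟨φ, hφ, hφ0, hdφ⟩ : ∃ φ : SmoothFun Ω, dy φ = 0 ∧ φ ≠ 0 ∧ d • φ = 0 := by
    rcases hd with rfl | ⟨m, U, hU, hdU⟩
    · exact ⟨1, dy.map_one_eq_zero, smoothFun_one_ne_zero hK, zero_smul _ _⟩
    · rcases m with _ | m
      · rw [opFil_zero, Submodule.mem_bot] at hU
        rw [hU, pow_zero, add_zero] at hdU
        have : d = 1 := Subtype.ext hdU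
        exact (hI (by rw [this, Ideal.span_singleton_one])).elim
      · obtain ⟨φ, h1, h2, h3⟩ := exists_annihilated_of_monic hK hU
        refine ⟨φ, h1, h2, ?_⟩
        rw [← hdU] at h3
        exact h3
  refine ⟨φ, hφ, hφ0, fun T hT => ?_⟩
  obtain ⟨Q, rfl⟩ := Ideal.mem_span_singleton'.1 hT
  rw [mul_smul, hdφ, smul_zero]

theorem isKernelReducible_of_isOperatorReducible {k : ℕ} {L : Fin k → DiffOp Ω}
    (h : IsOperatorReducible K L) : IsKernelReducible L := by
  obtain ⟨p, hpk, M, R, -, hR, hL, hinv⟩ := h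
  have hC := dx_mem_xConst hK
  have := opRing_isNoetherianRing hC (exists_inv_xConst hK)
  let R' : Matrix (Fin p) (Fin k) (opRing dx (xConst K) hC) := fun i j =>
    ⟨(R i j).toEnd, mem_opSpan_iff.2 ⟨R i j, isX_iff.1 (hR i j), rfl⟩⟩
  have hN : Submodule.span (opRing dx (xConst K) hC) (Set.range R') ≠ ⊤ := by
    intro htop
    obtain ⟨S', h1, h2⟩ := exists_inverse_of_span_eq_top hpk R' htop
    choose S hS hSS using fun i j => mem_opSpan_iff.1 (S' i j).2
    have e1 : R.map DiffOp.toEnd = R'.map (opRing dx (xConst K) hC).subtype := rfl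
    have e2 : (Matrix.of S).map DiffOp.toEnd = S'.map (opRing dx (xConst K) hC).subtype := by
      ext1 i j
      exact hSS i j
    refine hinv ⟨Matrix.of S, fun i j => isX_iff.2 (hS i j), ?_, ?_⟩
    · rw [e1, e2, ← Matrix.map_mul, h1, Matrix.map_one _ (map_zero _) (map_one _)]
    · rw [e1, e2, ← Matrix.map_mul, h2, Matrix.map_one _ (map_zero _) (map_one _)]
  obtain ⟨φ, hφ, hφ0, hann⟩ := exists_annihilated_vector {a : SmoothFun Ω | dy a = 0}
    (fun (T : opRing dx (xConst K) hC) a ha => dy_apply_eq_zero (T := T.1) T.2 ha)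
    (exists_annihilated_of_ne_top hK) _ hN
  refine (isKernelReducible_iff L).2 ⟨φ, hφ, hφ0, ?_⟩
  have hrow : ∀ i, ∑ j, (R i j).toEnd (φ j) = 0 := fun i =>
    hann (R' i) (Submodule.subset_span ⟨i, rfl⟩)
  calc ∑ j, (L j).toEnd (φ j) = ∑ j, ∑ i, (M i).toEnd ((R i j).toEnd (φ j)) :=
        Finset.sum_congr rfl fun j _ => by rw [hL, LinearMap.sum_apply]; rfl
    _ = ∑ i, (M i).toEnd (∑ j, (R i j).toEnd (φ j)) := by
        rw [Finset.sum_comm]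
        exact Finset.sum_congr rfl fun i _ => (map_sum _ _ _).symm
    _ = 0 := Finset.sum_eq_zero fun i _ => by rw [hrow, map_zero]

omit hK in
theorem exists_linearIndependent_expansion {F V : Type*} [Field F] [AddCommGroup V] [Module F V]
    (s : Finset V) : ∃ (r : ℕ) (e : Fin r → V), LinearIndependent F e ∧
      (∀ i, e i ∈ Submodule.span F (s : Set V)) ∧
      ∀ v ∈ s, ∃ c : Fin r → F, v = ∑ i, c i • e i := by
  let b := Module.finBasis F (Submodule.span F (s : Set V))
  refine ⟨_, fun i => b i, ?_, fun i => (b i).2, fun v hv => ?_⟩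
  · exact b.linearIndependent.map' (Submodule.subtype _) (Submodule.ker_subtype _)
  · refine ⟨b.repr ⟨v, Submodule.subset_span hv⟩, ?_⟩
    have := congrArg Subtype.val (b.sum_repr ⟨v, Submodule.subset_span hv⟩)
    rw [AddSubmonoidClass.coe_finsetSum] at this
    exact this.symm

/-- The coefficients of finitely many operators over `K` expand along finitely many elements of `K`
that are independent over the functions of `x`. -/
theorem exists_coefficient_expansion {k : ℕ} {L : Fin k → DiffOp Ω} (hL : ∀ i, (L i).IsXY K) :
    ∃ (r : ℕ) (e : Fin r → SmoothFun Ω), (∀ α, e α ∈ K) ∧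
      (∀ c : Fin r → SmoothFun Ω, (∀ α, c α ∈ xConst K) → ∑ α, e α * c α = 0 → c = 0) ∧
      ∀ i n, ∃ c : Fin r → xConst K, L i n = ∑ α, e α * c α := by
  classical
  let s : Finset (SmoothFun Ω) := Finset.univ.biUnion fun i => (L i).support.image (L i)
  obtain ⟨r, e, hli, he, hs⟩ :=
    @exists_linearIndependent_expansion (xConst K) (SmoothFun Ω) (xConst_isField hK).toField _ _ s
  refine ⟨r, e, fun α => ?_, fun c hc h0 => ?_, fun i n => ?_⟩
  · have : ∀ x ∈ Submodule.span (xConst K) (s : Set (SmoothFun Ω)), x ∈ K := by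
      intro x hx
      induction hx using Submodule.span_induction with
      | mem x hx =>
        simp only [s, Finset.coe_biUnion, Set.mem_iUnion, Finset.coe_image] at hx
        obtain ⟨i, _, n, _, rfl⟩ := hx
        exact hL i n
      | zero => exact zero_mem _
      | add x y _ _ hx hy => exact add_mem hx hy
      | smul a x _ hx => exact mul_mem a.2.1 hx
    exact this _ (he α)
  · have h1 : LinearIndependent (xConst K) e := hli
    rw [Fintype.linearIndependent_iff] at h1
    ext1 α
    refine congrArg Subtype.val (h1 (fun α => ⟨c α, hc α⟩) ?_ α)
    rw [← h0]
    exact Finset.sum_congr rfl fun α _ => mul_comm _ _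
  · by_cases hn : n ∈ (L i).support
    · obtain ⟨c, hc⟩ := hs (L i n) (Finset.mem_biUnion.2
        ⟨i, Finset.mem_univ _, Finset.mem_image_of_mem _ hn⟩)
      exact ⟨c, hc.trans (Finset.sum_congr rfl fun α _ => mul_comm _ _)⟩
    · exact ⟨0, by simp [Finsupp.notMem_support_iff.1 hn]⟩

theorem isOperatorReducible_of_isKernelReducible {k : ℕ} {L : Fin k → DiffOp Ω}
    (hL : ∀ i, (L i).IsXY K) (h : IsKernelReducible L) : IsOperatorReducible K L := by
  obtain ⟨φ, hφ, hφ0, hsum⟩ := (isKernelReducible_iff L).1 h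
  have hC := dx_mem_xConst hK
  have := opRing_isPrincipalIdealRing hC (exists_inv_xConst hK)
  obtain ⟨r, e, he, hli, hexp⟩ := exists_coefficient_expansion hK hL
  choose c hc using hexp
  let row : Fin r → Fin k → opRing dx (xConst K) hC := fun α i =>
    ⟨∑ n ∈ (L i).support, c i n α • derivEnd dx ^ n, sum_mem (S := opSpan dx (xConst K)) fun n _ =>
      Submodule.smul_mem (opSpan dx (xConst K)) _ (Submodule.subset_span ⟨n, rfl⟩)⟩
  have hLrow : ∀ i, (L i).toEnd = ∑ α, e α • (row α i : Module.End ℤ (SmoothFun Ω)) := by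
    intro i
    ext1 a
    rw [toEnd_apply, LinearMap.sum_apply]
    simp only [row, LinearMap.smul_apply, LinearMap.sum_apply, Finset.smul_sum, Subring.smul_def,
      smul_eq_mul]
    rw [Finset.sum_comm]
    refine Finset.sum_congr rfl fun n _ => ?_
    rw [hc i n, Finset.sum_mul]
    exact Finset.sum_congr rfl fun α _ => mul_assoc _ _ _
  -- Each `row α` maps `φ` to a function of `x`, and `∑ e α * (row α φ) = L φ = 0`, so independence
  -- of the `e α` applies.
  have hann : ∀ α, ∑ i, row α i • φ i = 0 := by
    refine congrFun (eq_zero_of_sum_mul_eq_zero hK r e he hli (fun α => ∑ i, row α i • φ i)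
      (fun α => ?_) ?_)
    · rw [map_sum]
      exact Finset.sum_eq_zero fun i _ => dy_apply_eq_zero (row α i).2 (hφ i)
    · rw [← hsum]
      simp only [Finset.mul_sum, hLrow, LinearMap.sum_apply]
      rw [Finset.sum_comm]
      rfl
  obtain ⟨v, hv⟩ := exists_fin_generators k (Submodule.span _ (Set.range row))
  have hspan : ∀ w ∈ Submodule.span (opRing dx (xConst K) hC) (Set.range row),
      ∑ i, w i • φ i = 0 := by
    intro w hw
    induction hw using Submodule.span_induction with
    | mem x hx => obtain ⟨α, rfl⟩ := hx; exact hann α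
    | zero => exact Finset.sum_eq_zero fun i _ => zero_smul _ _
    | add x y _ _ hx hy => simp only [Pi.add_apply, add_smul, Finset.sum_add_distrib, hx, hy, add_zero]
    | smul a x _ hx => simp only [Pi.smul_apply, smul_eq_mul, mul_smul, ← Finset.smul_sum, hx, smul_zero]
  have hvann : ∀ j, ∑ i, v j i • φ i = 0 := fun j =>
    hspan _ (hv ▸ Submodule.subset_span ⟨j, rfl⟩)
  have hq : ∀ α, ∃ q : Fin k → opRing dx (xConst K) hC, ∑ j, q j • v j = row α := fun α =>
    (Submodule.mem_span_range_iff_exists_fun _).1 (hv ▸ Submodule.subset_span ⟨α, rfl⟩)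
  choose q hq using hq
  -- From `row α = ∑ q α j • v j`, the left factor of `L` is `M j = ∑ e α q α j`, and the rows of
  -- `R` are the `v j`.
  have hM : ∀ j, ∑ α, e α • (q α j : Module.End ℤ (SmoothFun Ω)) ∈ opSpan dx K := fun j =>
    sum_mem fun α _ => Submodule.smul_mem _ (⟨e α, he α⟩ : K)
      (opSpan_mono (C := xConst K) (fun a (ha : a ∈ xConst K) => ha.1) (q α j).2)
  choose M hMK hM using fun j => mem_opSpan_iff.1 (hM j)
  choose R hRK hR using fun i j => mem_opSpan_iff.1 (v i j).2
  refine ⟨k, le_rfl, M, Matrix.of R, hMK, fun i j => isX_iff.2 (hRK i j), fun i => ?_, ?_⟩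
  · rw [hLrow]
    simp only [Matrix.of_apply, hM, hR, Finset.sum_mul]
    rw [Finset.sum_comm]
    refine Finset.sum_congr rfl fun α _ => ?_
    rw [← hq α]
    simp only [Finset.sum_apply, Pi.smul_apply, smul_eq_mul, AddSubmonoidClass.coe_finsetSum,
      Subring.coe_mul, Finset.smul_sum, smul_mul_assoc]
  -- A left inverse already contradicts `R φ = 0` with `φ ≠ 0`.
  · rintro ⟨S, -, -, hSR⟩
    refine hφ0 (funext fun i => ?_)
    have h1 : ∀ j, ∑ l, (R j l).toEnd (φ l) = 0 := fun j => by
      rw [← hvann j]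
      exact Finset.sum_congr rfl fun l _ => by rw [hR]; rfl
    have h2 : ∀ l, ∑ j, (S i j).toEnd * (R j l).toEnd =
        (1 : Matrix (Fin k) (Fin k) (Module.End ℤ (SmoothFun Ω))) i l := fun l => by
      rw [← hSR, Matrix.mul_apply]
      rfl
    calc φ i = ∑ l, ((1 : Matrix (Fin k) (Fin k) (Module.End ℤ (SmoothFun Ω))) i l) (φ l) := by
          rw [Finset.sum_eq_single i]
          · simp
          · intro l _ hl
            simp [Matrix.one_apply_ne' hl]
          · simp
      _ = ∑ l, ∑ j, (S i j).toEnd ((R j l).toEnd (φ l)) :=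
          Finset.sum_congr rfl fun l _ => by rw [← h2, LinearMap.sum_apply]; rfl
      _ = ∑ j, (S i j).toEnd (∑ l, (R j l).toEnd (φ l)) := by
          rw [Finset.sum_comm]
          exact Finset.sum_congr rfl fun j _ => (map_sum _ _ _).symm
      _ = 0 := Finset.sum_eq_zero fun j _ => by rw [h1, map_zero]

end Field

end Multiintegral

end

theorem mainTheorem4 (Ω : TopologicalSpace.Opens (ℝ × ℝ))
    (K : Subring (Multiintegral.SmoothFun Ω)) (hK : Multiintegral.IsDifferentialField K)
    (k : ℕ) (L : Fin k → Multiintegral.DiffOp Ω) (hL : ∀ i, (L i).IsXY K) :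
    Multiintegral.IsOperatorReducible K L ↔ Multiintegral.IsKernelReducible L :=
  ⟨Multiintegral.isKernelReducible_of_isOperatorReducible hK,
    Multiintegral.isOperatorReducible_of_isKernelReducible hK hL⟩
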